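/- A real matrix is called Metzler if all its off-diagonal entries are nonnegative, and $X=(x_{ij})$ is called upper Hessenberg if $x_{ij}=0$ whenever $i>j+1$; $e_1=(1,0,0,0)^{\mathsf T}$. Let $A\in\mathbb{R}^{4\times 4}$ be Metzler and let $b\in\mathbb{R}^4$ be entrywise nonnegative. Suppose that $A$ is diagonalizable (over $\mathbb{C}$) by an invertible $V\in\mathbb{C}^{4\times 4}$, i.e. $V^{-1}AV=D$ with $D$ diagonal, such that all entries of $V^{-1}e_1$ and all entries of $V^{-1}b$ are nonzero. Then there exists an invertible real matrix $T\in\mathbb{R}^{4\times 4}$ (not necessarily nonnegative) such that $(T^{-1}AT,\,T^{-1}b)$ is in continuous-time positive controller-Hessenberg form, that is, $T^{-1}AT$ is a Metzler upper Hessenberg matrix and $T^{-1}b=e_1$. -/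

import Mathlib

/-- A real square matrix is *Metzler* if all its off-diagonal entries are nonnegative. -/
def IsMetzler {n : ℕ} (X : Matrix (Fin n) (Fin n) ℝ) : Prop :=
  ∀ i j : Fin n, i ≠ j → 0 ≤ X i j

/-- A matrix is *upper Hessenberg* if its `(i, j)` entry vanishes whenever `i > j + 1`. -/
def IsUpperHessenberg {n : ℕ} (X : Matrix (Fin n) (Fin n) ℝ) : Prop :=
  ∀ i j : Fin n, (j : ℕ) + 1 < (i : ℕ) → X i j = 0

/-- The pair `(A, b)` is in *continuous-time positive controller-Hessenberg form*: `A` is a Metzler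
upper Hessenberg matrix and `b` is the first canonical unit vector `e₁`. -/
def IsCTPositiveControllerHessenberg {n : ℕ} [NeZero n]
    (A : Matrix (Fin n) (Fin n) ℝ) (b : Fin n → ℝ) : Prop :=
  IsMetzler A ∧ IsUpperHessenberg A ∧ b = Pi.single 0 1

/-!
All modes of `(A, b)` are excited by `b`, so up to similarity the pair is determined by the spectrum
`d` of `A` alone. It therefore suffices to find one Metzler upper Hessenberg matrix with spectrum `d`
all of whose modes are excited by `e₁` (`IsHessenbergRealizable`); the complex similarity to
`(A, b)` can be made real (`IsHessenbergRealizable.exists_similarity`).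

The candidates have ones below the diagonal, and nonnegative entries above it only in the last
column. Such a matrix records the expansion of the characteristic polynomial in a Newton basis with
nodes on the diagonal, and its left eigenvectors are explicit
(`isHessenbergRealizable_of_injective`). A repeated eigenvalue splits off as a diagonal entry. For a
real spectrum, bidiagonal matrices suffice.

If the spectrum is not real, the Perron–Frobenius property
(`IsMetzler.exists_dominant_eigenvalue`) makes it of the form `ρ, l, a ± iω` with `l, a ≤ ρ`. When
`√3 |ω| ≤ ρ - a`, the eigenvalues `ρ, a ± iω` already fit into a `3 × 3` block. Otherwise two facts
about Metzler matrices are needed. First, `l` is smaller than the mean of the spectrum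
(`IsMetzler.sq_trace_le_three_mul_trace_sq`): after a shift by `l`, either a diagonal entry is
nonnegative, or some 2-cycle dominates the product of its diagonal entries, and both force the trace
inequality equivalent to `√3 |ω| ≤ ρ - a`; or else the characteristic polynomial could not be
positive just to the left of its root `l`. Second, after the trace is shifted to zero, `tr A ^ 2 = 12 τ ^ 2` with `τ ≥ 0` implies
`tr A ^ 3 ≥ -24 τ ^ 3` (`IsMetzler.neg_le_trace_pow_three`). These inequalities are exactly what
makes the Newton coefficients of the candidate nonnegative
(`IsMetzler.isHessenbergRealizable_of_conj`).
-/

/-! ### Similarity of pairs with the same spectrum -/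

/-- The prescribed spectrum `d` is carried by a real Metzler upper Hessenberg matrix `H` whose pair
with `e₁` excites every mode. The rows of `Y` are left eigenvectors of `H`; since `Y` plays the part
of `V⁻¹`, the condition on its first column says that no entry of `V⁻¹ e₁` vanishes. -/
def IsHessenbergRealizable (d : Fin 4 → ℂ) : Prop :=
  ∃ (H : Matrix (Fin 4) (Fin 4) ℝ) (Y : Matrix (Fin 4) (Fin 4) ℂ),
    IsMetzler H ∧ IsUpperHessenberg H ∧ IsUnit Y ∧
      Y * H.map (fun x : ℝ => (x : ℂ)) = Matrix.diagonal d * Y ∧ ∀ i, Y i 0 ≠ 0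

theorem IsHessenbergRealizable.of_perm {d : Fin 4 → ℂ} (σ : Equiv.Perm (Fin 4))
    (h : IsHessenbergRealizable (d ∘ σ)) : IsHessenbergRealizable d := by
  obtain ⟨H, Y, h1, h2, h3, h4, h5⟩ := h
  refine ⟨H, Y.submatrix σ.symm (Equiv.refl _), h1, h2, ?_, ?_, fun i => h5 _⟩
  · rwa [Matrix.isUnit_submatrix_equiv]
  · ext i j
    have := congrFun (congrFun h4 (σ.symm i)) j
    rw [Matrix.diagonal_mul] at this ⊢
    simpa [Matrix.mul_apply] using this

/-- A pencil of real matrices that contains an invertible matrix at a complex parameter contains one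
at a real parameter: its determinant is a polynomial that does not vanish identically. -/
theorem exists_real_isUnit_add_smul {n : ℕ} (X Z : Matrix (Fin n) (Fin n) ℝ)
    (h : IsUnit (X.map (fun x : ℝ => (x : ℂ)) + Complex.I • Z.map (fun x : ℝ => (x : ℂ)))) :
    ∃ t : ℝ, IsUnit (X + t • Z) := by
  let P : Polynomial ℝ :=
    (X.map Polynomial.C + (Polynomial.X : Polynomial ℝ) • Z.map Polynomial.C).det
  have hP : P ≠ 0 := by
    intro h0
    have h1 : P.eval₂ Complex.ofRealHom Complex.I = 0 := by rw [h0]; simp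
    have h2 : P.eval₂ Complex.ofRealHom Complex.I =
        (X.map (fun x : ℝ => (x : ℂ)) + Complex.I • Z.map (fun x : ℝ => (x : ℂ))).det := by
      change Polynomial.eval₂RingHom Complex.ofRealHom Complex.I _ = _
      rw [RingHom.map_det]
      congr 1
      ext i j
      simp [mul_comm (Complex.I)]
    rw [Matrix.isUnit_iff_isUnit_det, ← h2, h1] at h
    simp at h
  obtain ⟨t, ht⟩ := Polynomial.exists_eval_ne_zero_of_natDegree_lt_card P hP
    (by simpa using Cardinal.natCast_lt_aleph0.trans_le (Cardinal.aleph0_le_mk ℝ))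
  refine ⟨t, ?_⟩
  rw [Matrix.isUnit_iff_isUnit_det, isUnit_iff_ne_zero]
  have h2 : P.eval t = (X + t • Z).det := by
    change Polynomial.evalRingHom t _ = _
    rw [RingHom.map_det]
    congr 1
    ext i j
    simp [mul_comm t]
  rwa [← h2]

/-- Two diagonalizable pairs with the same spectrum, in which every mode is excited, are similar.
The similarity found over `ℂ` is replaced by a real one, because its real and imaginary parts both
intertwine the two pairs. -/
theorem IsHessenbergRealizable.exists_similarity {d : Fin 4 → ℂ} (h : IsHessenbergRealizable d)
    (A : Matrix (Fin 4) (Fin 4) ℝ) (b : Fin 4 → ℝ) (V : Matrix (Fin 4) (Fin 4) ℂ) (hV : IsUnit V)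
    (hdiag : V⁻¹ * A.map (fun x : ℝ => (x : ℂ)) * V = Matrix.diagonal d)
    (hVb : ∀ i, (V⁻¹.mulVec (fun j => (b j : ℂ))) i ≠ 0) :
    ∃ T : Matrix (Fin 4) (Fin 4) ℝ, IsUnit T ∧
      IsCTPositiveControllerHessenberg (T⁻¹ * A * T) (T⁻¹.mulVec b) := by
  obtain ⟨H, Y, hM, hH, hY, hYH, hY0⟩ := h
  have hVd : IsUnit V.det := (Matrix.isUnit_iff_isUnit_det _).1 hV
  set v := V⁻¹.mulVec (fun j => (b j : ℂ)) with hv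
  let s : Fin 4 → ℂ := fun i => v i / Y i 0
  let W := V * Matrix.diagonal s * Y
  have hW : IsUnit W := by
    refine (hV.mul ?_).mul hY
    rw [Matrix.isUnit_iff_isUnit_det, Matrix.det_diagonal, isUnit_iff_ne_zero]
    exact Finset.prod_ne_zero_iff.2 fun i _ => div_ne_zero (hVb i) (hY0 i)
  have hAV : A.map (fun x : ℝ => (x : ℂ)) * V = V * Matrix.diagonal d := by
    rw [← hdiag, ← Matrix.mul_assoc, ← Matrix.mul_assoc, Matrix.mul_nonsing_inv _ hVd,
      Matrix.one_mul]
  have hAW : A.map (fun x : ℝ => (x : ℂ)) * W = W * H.map (fun x : ℝ => (x : ℂ)) := by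
    have hcomm : Matrix.diagonal d * Matrix.diagonal s = Matrix.diagonal s * Matrix.diagonal d := by
      simp [Matrix.diagonal_mul_diagonal, mul_comm]
    calc A.map (fun x : ℝ => (x : ℂ)) * W
        = (A.map (fun x : ℝ => (x : ℂ)) * V) * Matrix.diagonal s * Y := by
          simp only [W, Matrix.mul_assoc]
      _ = V * (Matrix.diagonal d * Matrix.diagonal s) * Y := by
          rw [hAV]; simp only [Matrix.mul_assoc]
      _ = V * Matrix.diagonal s * (Matrix.diagonal d * Y) := by
          rw [hcomm]; simp only [Matrix.mul_assoc]
      _ = W * H.map (fun x : ℝ => (x : ℂ)) := by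
          rw [← hYH]; simp only [W, Matrix.mul_assoc]
  have hWb : ∀ i, W i 0 = b i := by
    intro i
    have h1 : (Matrix.diagonal s * Y).col 0 = v := by
      ext k
      simp [Matrix.diagonal_mul, s, div_mul_cancel₀ _ (hY0 k)]
    have h2 : W i 0 = V.mulVec ((Matrix.diagonal s * Y).col 0) i := by
      simp [W, Matrix.mul_assoc, Matrix.mul_apply (M := V), Matrix.mulVec, dotProduct]
    rw [h2, h1, hv, Matrix.mulVec_mulVec, Matrix.mul_nonsing_inv _ hVd, Matrix.one_mulVec]
  let X := W.map Complex.re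
  let Z := W.map Complex.im
  have hAX : A * X = X * H := by
    ext i j
    have := congrArg Complex.re (congrFun (congrFun hAW i) j)
    simpa [Matrix.mul_apply, X] using this
  have hAZ : A * Z = Z * H := by
    ext i j
    have := congrArg Complex.im (congrFun (congrFun hAW i) j)
    simpa [Matrix.mul_apply, Z] using this
  have hXZ : X.map (fun x : ℝ => (x : ℂ)) + Complex.I • Z.map (fun x : ℝ => (x : ℂ)) = W := by
    ext i j
    simp [X, Z, mul_comm Complex.I]
  obtain ⟨t, ht⟩ := exists_real_isUnit_add_smul X Z (by rwa [hXZ])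
  have htd : IsUnit (X + t • Z).det := (Matrix.isUnit_iff_isUnit_det _).1 ht
  have hb : b = (X + t • Z).mulVec (Pi.single 0 1) := by
    ext i
    simp [X, Z, hWb i]
  refine ⟨X + t • Z, ht, ?_⟩
  have hAT : (X + t • Z)⁻¹ * A * (X + t • Z) = H := by
    have : A * (X + t • Z) = (X + t • Z) * H := by
      rw [Matrix.mul_add, Matrix.add_mul, hAX, Matrix.mul_smul, hAZ, Matrix.smul_mul]
    rw [Matrix.mul_assoc, this, ← Matrix.mul_assoc, Matrix.nonsing_inv_mul _ htd, Matrix.one_mul]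
  rw [hAT]
  refine ⟨hM, hH, ?_⟩
  rw [hb, Matrix.mulVec_mulVec, Matrix.nonsing_inv_mul _ htd, Matrix.one_mulVec]

/-! ### Hessenberg matrices from Newton expansions -/

/-- A Metzler variant of the companion matrix: its characteristic polynomial is
`(X - c₀)(X - c₁)(X - c₂)(X - c₃) - q(X - c₀)(X - c₁) - C(X - c₀) - F`, and the left eigenvector at a
root `z` consists of the Newton products `1, z - c₀, (z - c₀)(z - c₁), (z - c₀)(z - c₁)(z - c₂)`. -/
theorem isHessenbergRealizable_of_injective {d : Fin 4 → ℂ} (hd : Function.Injective d)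
    (c₀ c₁ c₂ c₃ : ℝ) {q C F : ℝ} (hq : 0 ≤ q) (hC : 0 ≤ C) (hF : 0 ≤ F)
    (hroot : ∀ i, (d i - c₀) * (d i - c₁) * (d i - c₂) * (d i - c₃) =
      q * ((d i - c₀) * (d i - c₁)) + C * (d i - c₀) + F) :
    IsHessenbergRealizable d := by
  refine ⟨!![c₀, 0, 0, F; 1, c₁, 0, C; 0, 1, c₂, q; 0, 0, 1, c₃],
    Matrix.of fun i => ![1, d i - c₀, (d i - c₀) * (d i - c₁),
      (d i - c₀) * (d i - c₁) * (d i - c₂)], ?_, ?_, ?_, ?_, ?_⟩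
  · intro i j hij
    fin_cases i <;> fin_cases j <;> simp_all
  · intro i j hij
    fin_cases i <;> fin_cases j <;> simp_all
  · rw [Matrix.isUnit_iff_isUnit_det, isUnit_iff_ne_zero]
    have hne : ∀ i j, i ≠ j → d i - d j ≠ 0 := fun i j h => sub_ne_zero.2 (hd.ne h)
    have : (Matrix.of fun i => ![1, d i - c₀, (d i - c₀) * (d i - c₁),
        (d i - c₀) * (d i - c₁) * (d i - c₂)]).det =
        (d 1 - d 0) * (d 2 - d 0) * (d 3 - d 0) * (d 2 - d 1) * (d 3 - d 1) * (d 3 - d 2) := by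
      simp [Matrix.det_succ_row_zero, Fin.sum_univ_succ, Fin.succAbove]
      ring
    rw [this]
    simp [hne]
  · ext i j
    rw [Matrix.diagonal_mul]
    have := hroot i
    fin_cases j <;> simp [Matrix.mul_apply, Fin.sum_univ_succ]
    · ring
    · ring
    · linear_combination -this
  · simp

/-- The analogue of `isHessenbergRealizable_of_injective` for three modes, with a repeated real
eigenvalue `κ` appended as a separate block. -/
theorem isHessenbergRealizable_of_three {d : Fin 4 → ℂ} (h01 : d 0 ≠ d 1) (h02 : d 0 ≠ d 2)
    (h12 : d 1 ≠ d 2) (c₀ c₁ c₂ κ : ℝ) {q C : ℝ} (hq : 0 ≤ q) (hC : 0 ≤ C) (hκ : d 3 = κ)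
    (hroot : ∀ i, (d i - c₀) * (d i - c₁) * (d i - c₂) = q * (d i - c₀) + C) :
    IsHessenbergRealizable d := by
  refine ⟨!![c₀, 0, C, 0; 1, c₁, q, 0; 0, 1, c₂, 0; 0, 0, 0, κ],
    Matrix.of fun i => ![1, d i - c₀, (d i - c₀) * (d i - c₁), if i = 3 then 1 else 0],
    ?_, ?_, ?_, ?_, ?_⟩
  · intro i j hij
    fin_cases i <;> fin_cases j <;> simp_all
  · intro i j hij
    fin_cases i <;> fin_cases j <;> simp_all
  · rw [Matrix.isUnit_iff_isUnit_det, isUnit_iff_ne_zero]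
    have : (Matrix.of fun i : Fin 4 => ![1, d i - c₀, (d i - c₀) * (d i - c₁),
        if i = 3 then (1 : ℂ) else 0]).det = (d 1 - d 0) * (d 2 - d 0) * (d 2 - d 1) := by
      simp [Matrix.det_succ_row_zero, Fin.sum_univ_succ, Fin.succAbove]
      ring
    rw [this]
    simp [sub_ne_zero, h01.symm, h02.symm, h12.symm]
  · ext i j
    rw [Matrix.diagonal_mul]
    have := hroot i
    fin_cases j <;> simp [Matrix.mul_apply, Fin.sum_univ_succ]
    · ring
    · linear_combination -this
    · split_ifs with h
      · rw [h, hκ]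
      · rfl
  · simp

theorem isHessenbergRealizable_of_two {d : Fin 4 → ℂ} (h01 : d 0 ≠ d 1) (c₀ c₁ c₂ c₃ : ℝ)
    (h2 : d 2 = c₂) (h3 : d 3 = c₃) (hroot : ∀ i, (d i - c₀) * (d i - c₁) = 0) :
    IsHessenbergRealizable d := by
  refine ⟨!![c₀, 0, 0, 0; 1, c₁, 0, 0; 0, 0, c₂, 0; 0, 0, 0, c₃],
    Matrix.of fun i => ![1, d i - c₀, if i = 2 then 1 else 0, if i = 3 then 1 else 0],
    ?_, ?_, ?_, ?_, ?_⟩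
  · intro i j hij
    fin_cases i <;> fin_cases j <;> simp_all
  · intro i j hij
    fin_cases i <;> fin_cases j <;> simp_all
  · rw [Matrix.isUnit_iff_isUnit_det, isUnit_iff_ne_zero]
    have : (Matrix.of fun i : Fin 4 => ![1, d i - c₀, if i = 2 then (1 : ℂ) else 0,
        if i = 3 then (1 : ℂ) else 0]).det = d 1 - d 0 := by
      simp [Matrix.det_succ_row_zero, Fin.sum_univ_succ, Fin.succAbove]
    rw [this]
    exact sub_ne_zero.2 h01.symm
  · ext i j
    rw [Matrix.diagonal_mul]
    have := hroot i
    fin_cases j <;> simp [Matrix.mul_apply, Fin.sum_univ_succ]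
    · linear_combination -this
    · split_ifs with h
      · rw [h, h2]
      · rfl
    · split_ifs with h
      · rw [h, h3]
      · rfl
  · simp

theorem isHessenbergRealizable_of_const {d : Fin 4 → ℂ} (c : ℝ) (h : ∀ i, d i = c) :
    IsHessenbergRealizable d := by
  refine ⟨Matrix.diagonal fun _ => c, !![1, 0, 0, 0; 1, 1, 0, 0; 1, 0, 1, 0; 1, 0, 0, 1],
    ?_, ?_, ?_, ?_, ?_⟩
  · intro i j hij
    simp [hij]
  · intro i j hij
    exact Matrix.diagonal_apply_ne _ (by rintro rfl; omega)
  · rw [Matrix.isUnit_iff_isUnit_det]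
    simp [Matrix.det_succ_row_zero, Fin.sum_univ_succ, Fin.succAbove]
  · ext i j
    rw [Matrix.diagonal_map (by simp), Matrix.diagonal_mul, Matrix.mul_diagonal, h i, mul_comm]
  · intro i
    fin_cases i <;> simp

/-! ### Real spectra -/

theorem isHessenbergRealizable_ofReal (r : Fin 4 → ℝ) :
    IsHessenbergRealizable fun i => (r i : ℂ) := by
  by_cases hr : Function.Injective r
  · refine isHessenbergRealizable_of_injective (Complex.ofReal_injective.comp hr)
      (r 0) (r 1) (r 2) (r 3) le_rfl le_rfl le_rfl fun i => ?_
    fin_cases i <;> simp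
  obtain ⟨i, j, hij, hne⟩ := Function.not_injective_iff.1 hr
  obtain ⟨σ, hσ0, hσ3⟩ : ∃ σ : Equiv.Perm (Fin 4), σ 0 = i ∧ σ 3 = j := by
    clear hij
    revert i j
    decide
  refine .of_perm σ ?_
  suffices h : ∀ s : Fin 4 → ℝ, s 3 = s 0 → IsHessenbergRealizable fun i => (s i : ℂ) from
    h (r ∘ σ) (by simp [hσ0, hσ3, hij])
  intro s h30
  by_cases h01 : s 0 = s 1
  · by_cases h02 : s 0 = s 2
    · exact isHessenbergRealizable_of_const (s 0) fun i => by
        fin_cases i <;> simp [← h01, ← h02, h30]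
    · refine .of_perm (Equiv.swap 1 2) ?_
      have e0 : Equiv.swap (1 : Fin 4) 2 0 = 0 := by decide
      have e3 : Equiv.swap (1 : Fin 4) 2 3 = 3 := by decide
      refine isHessenbergRealizable_of_two ?_ (s 0) (s 2) (s 1) (s 3) ?_ ?_ fun i => ?_
      · simpa [e0] using h02
      · simp
      · simp [e3]
      · fin_cases i <;> simp [e0, e3, h30, ← h01]
  by_cases h02 : s 0 = s 2
  · refine isHessenbergRealizable_of_two ?_ (s 0) (s 1) (s 2) (s 3) rfl rfl fun i => ?_
    · simpa using h01
    · fin_cases i <;> simp [h30, ← h02]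
  by_cases h12 : s 1 = s 2
  · refine isHessenbergRealizable_of_two ?_ (s 0) (s 1) (s 2) (s 3) rfl rfl fun i => ?_
    · simpa using h01
    · fin_cases i <;> simp [h30, ← h12]
  · refine isHessenbergRealizable_of_three ?_ ?_ ?_ (s 0) (s 1) (s 2) (s 3) le_rfl le_rfl rfl
      fun i => ?_
    · simpa using h01
    · simpa using h02
    · simpa using h12
    · fin_cases i <;> simp [h30]

/-! ### The dominant eigenvalue of a Metzler matrix -/

/-- A Metzler matrix `A` for which `z - A` maps some positive vector to a positive vector is inverse
monotone after the shift. -/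
theorem IsMetzler.nonneg_of_sub_mulVec_nonneg {n : ℕ} {A : Matrix (Fin n) (Fin n) ℝ}
    (hA : IsMetzler A) {z : ℝ} {x : Fin n → ℝ} (hx : ∀ i, 0 < x i)
    (hzx : ∀ i, (A.mulVec x) i < z * x i) {y : Fin n → ℝ}
    (hy : ∀ i, (A.mulVec y) i ≤ z * y i) : ∀ i, 0 ≤ y i := by
  by_contra! ⟨i₀, hi₀⟩
  -- At the index minimizing `y i / x i`, the comparison of `y` with a multiple of `x` is sharp.
  obtain ⟨k, -, hk⟩ := Finset.exists_min_image Finset.univ (fun i => y i / x i) ⟨i₀, by simp⟩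
  set c := y k / x k with hc
  have hc0 : c < 0 := (hk i₀ (by simp)).trans_lt (div_neg_of_neg_of_pos hi₀ (hx i₀))
  have hge : ∀ j, c * x j ≤ y j := fun j => (le_div_iff₀ (hx j)).1 (hk j (by simp))
  have hyk : y k = c * x k := by rw [hc, div_mul_cancel₀ _ (hx k).ne']
  have h1 : c * (A.mulVec x) k ≤ (A.mulVec y) k := by
    simp only [Matrix.mulVec, dotProduct, Finset.mul_sum]
    refine Finset.sum_le_sum fun j _ => ?_
    rcases eq_or_ne k j with rfl | hkj
    · rw [hyk]; exact le_of_eq (by ring)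
    · have := mul_le_mul_of_nonneg_left (hge j) (hA k j hkj)
      linarith
  have h2 := mul_lt_mul_of_neg_left (hzx k) hc0
  have h3 := hy k
  rw [hyk] at h3
  linarith

/-- The set of `z` for which `z - A` maps some positive vector to a positive vector. For a Metzler
matrix it is the open half-line to the right of the dominant eigenvalue. -/
def positivityDomain {n : ℕ} (A : Matrix (Fin n) (Fin n) ℝ) : Set ℝ :=
  {z | ∃ x : Fin n → ℝ, (∀ i, 0 < x i) ∧ ∀ i, (A.mulVec x) i < z * x i}

theorem positivityDomain_nonempty {n : ℕ} (A : Matrix (Fin n) (Fin n) ℝ) :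
    (positivityDomain A).Nonempty := by
  obtain ⟨M, hM⟩ := (Set.finite_range (A.mulVec 1)).bddAbove
  refine ⟨M + 1, 1, by simp, fun i => ?_⟩
  have := hM (Set.mem_range_self i)
  simp only [Pi.one_apply, mul_one]
  linarith

/-- If `A y ≥ a y` for a nonzero nonnegative vector `y`, then `a` bounds the positivity domain
from below. -/
theorem IsMetzler.lt_of_mem_positivityDomain {n : ℕ} {A : Matrix (Fin n) (Fin n) ℝ}
    (hA : IsMetzler A) {a : ℝ} {y : Fin n → ℝ} (hy : ∀ i, 0 ≤ y i) (hy0 : y ≠ 0)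
    (hay : ∀ i, a * y i ≤ (A.mulVec y) i) {z : ℝ} (hz : z ∈ positivityDomain A) : a < z := by
  obtain ⟨x, hx, hzx⟩ := hz
  by_contra! hza
  refine hy0 (funext fun i => le_antisymm ?_ (hy i))
  have := hA.nonneg_of_sub_mulVec_nonneg hx hzx (y := -y) (fun i => ?_) i
  · simpa using this
  · have h1 := hay i
    have h2 := mul_le_mul_of_nonneg_right hza (hy i)
    simp only [Matrix.mulVec_neg, Pi.neg_apply]
    linarith

/-- The real part of an eigenvalue bounds the positivity domain from below: the moduli of the
coordinates of an eigenvector form a vector `y` with `A y ≥ (Re μ) y`. -/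
theorem IsMetzler.re_lt_of_mem_positivityDomain {n : ℕ} {A : Matrix (Fin n) (Fin n) ℝ}
    (hA : IsMetzler A) {μ : ℂ} {v : Fin n → ℂ} (hv : v ≠ 0)
    (hAv : (A.map (fun x : ℝ => (x : ℂ))).mulVec v = μ • v) {z : ℝ}
    (hz : z ∈ positivityDomain A) : μ.re < z := by
  refine hA.lt_of_mem_positivityDomain (y := fun i => ‖v i‖) (fun i => norm_nonneg _) ?_ ?_ hz
  · intro h
    exact hv (funext fun i => norm_eq_zero.1 (congrFun h i))
  · intro i
    have h1 : (μ - A i i) * v i = ∑ j ∈ Finset.univ.erase i, (A i j : ℂ) * v j := by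
      have := congrFun hAv i
      simp only [Matrix.mulVec, dotProduct, Matrix.map_apply, Pi.smul_apply, smul_eq_mul] at this
      rw [← Finset.add_sum_erase _ _ (Finset.mem_univ i)] at this
      linear_combination -this
    have h2 : (μ.re - A i i) * ‖v i‖ ≤ ∑ j ∈ Finset.univ.erase i, A i j * ‖v j‖ := by
      calc (μ.re - A i i) * ‖v i‖ ≤ ‖(μ - A i i) * v i‖ := by
            rw [norm_mul]
            refine mul_le_mul_of_nonneg_right ?_ (norm_nonneg _)
            simpa using Complex.re_le_norm (μ - A i i)
        _ ≤ ∑ j ∈ Finset.univ.erase i, ‖(A i j : ℂ) * v j‖ := by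
            rw [h1]; exact norm_sum_le _ _
        _ = _ := by
            refine Finset.sum_congr rfl fun j hj => ?_
            rw [norm_mul, Complex.norm_real, Real.norm_of_nonneg
              (hA i j (Finset.ne_of_mem_erase hj).symm)]
    simp only [Matrix.mulVec, dotProduct]
    rw [← Finset.add_sum_erase _ _ (Finset.mem_univ i)]
    linarith

theorem positivityDomain_isOpen {n : ℕ} (A : Matrix (Fin n) (Fin n) ℝ) :
    IsOpen (positivityDomain A) := by
  have : positivityDomain A = ⋃ x ∈ {x : Fin n → ℝ | ∀ i, 0 < x i},
      {z | ∀ i, (A.mulVec x) i < z * x i} := by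
    ext z
    simp [positivityDomain]
  rw [this]
  refine isOpen_biUnion fun x _ => ?_
  simp only [Set.ofPred_forall]
  exact isOpen_iInter_of_finite fun i => isOpen_lt (by fun_prop) (by fun_prop)

theorem positivityDomain_upward {n : ℕ} {A : Matrix (Fin n) (Fin n) ℝ} {z w : ℝ}
    (hz : z ∈ positivityDomain A) (hzw : z ≤ w) : w ∈ positivityDomain A := by
  obtain ⟨x, hx, h⟩ := hz
  exact ⟨x, hx, fun i => (h i).trans_le (mul_le_mul_of_nonneg_right hzw (hx i).le)⟩

/-- The positivity domain can be left, moving downwards, only through an eigenvalue: where `z - A`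
is invertible, inverse monotonicity passes to the limit, and `(z - A)⁻¹ 1`, slightly perturbed, is
a witness. -/
theorem IsMetzler.mem_positivityDomain_of_isUnit {n : ℕ} {A : Matrix (Fin n) (Fin n) ℝ}
    (hA : IsMetzler A) {z : ℝ} (hz : ∀ w, z < w → w ∈ positivityDomain A)
    (hdet : (z • (1 : Matrix (Fin n) (Fin n) ℝ) - A).det ≠ 0) : z ∈ positivityDomain A := by
  let M : ℝ → Matrix (Fin n) (Fin n) ℝ := fun w => w • 1 - A
  let x : ℝ → Fin n → ℝ := fun w => (M w)⁻¹.mulVec 1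
  have hMc : Continuous M := by fun_prop
  have hMx : ∀ w, (M w).det ≠ 0 → ∀ i, w * x w i - (A.mulVec (x w)) i = 1 := by
    intro w hw i
    have h1 : (M w).mulVec (x w) = 1 := by
      rw [Matrix.mulVec_mulVec, Matrix.mul_nonsing_inv _ (isUnit_iff_ne_zero.2 hw),
        Matrix.one_mulVec]
    have h2 := congrFun h1 i
    simpa [M, Matrix.sub_mulVec, Matrix.smul_mulVec] using h2
  have hxc : ContinuousAt x z := by
    have h1 : ContinuousAt (fun w => (M w)⁻¹) z := by
      simp only [Matrix.inv_def, Ring.inverse_eq_inv']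
      exact (hMc.matrix_det.continuousAt.inv₀ hdet).smul hMc.matrix_adjugate.continuousAt
    exact (Continuous.matrix_mulVec continuous_id continuous_const).continuousAt.comp h1
  have hev : ∀ᶠ w in nhdsWithin z (Set.Ioi z), ∀ i, 0 ≤ x w i := by
    have h1 : ∀ᶠ w in nhds z, (M w).det ≠ 0 := hMc.matrix_det.continuousAt.eventually_ne hdet
    filter_upwards [h1.filter_mono nhdsWithin_le_nhds, self_mem_nhdsWithin] with w hw hzw
    obtain ⟨y, hy, hwy⟩ := hz w hzw
    refine hA.nonneg_of_sub_mulVec_nonneg hy hwy fun i => ?_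
    have := hMx w hw i
    linarith
  have hxz : ∀ i, 0 ≤ x z i := by
    intro i
    have h1 : Filter.Tendsto (fun w => x w i) (nhdsWithin z (Set.Ioi z)) (nhds (x z i)) :=
      ((continuous_apply i).continuousAt.comp hxc).tendsto.mono_left nhdsWithin_le_nhds
    exact ge_of_tendsto h1 (hev.mono fun w hw => hw i)
  have hpert : ∀ᶠ ε in nhdsWithin (0 : ℝ) (Set.Ioi 0),
      ∀ i, (A.mulVec (x z + ε • 1)) i < z * (x z + ε • (1 : Fin n → ℝ)) i := by
    refine Filter.Eventually.filter_mono nhdsWithin_le_nhds ?_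
    refine Filter.eventually_all.2 fun i => ?_
    have hc1 : Continuous fun ε : ℝ => (A.mulVec (x z + ε • 1)) i := by
      exact (continuous_apply i).comp (Continuous.matrix_mulVec continuous_const (by fun_prop))
    have hc2 : Continuous fun ε : ℝ => z * (x z + ε • (1 : Fin n → ℝ)) i := by
      simp only [Pi.add_apply, Pi.smul_apply]
      fun_prop
    refine hc1.continuousAt.eventually_lt hc2.continuousAt ?_
    have := hMx z hdet i
    simp only [zero_smul, add_zero]
    linarith
  obtain ⟨ε, hε, hε0⟩ := (hpert.and self_mem_nhdsWithin).exists
  refine ⟨x z + ε • 1, fun i => ?_, hε⟩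
  have := hxz i
  have h0 : 0 < ε := hε0
  simp only [Pi.add_apply, Pi.smul_apply, Pi.one_apply, smul_eq_mul, mul_one]
  linarith

/-- The Perron–Frobenius property of Metzler matrices: some real eigenvalue is at least the real
part of every eigenvalue. -/
theorem IsMetzler.exists_dominant_eigenvalue {n : ℕ} {A : Matrix (Fin n) (Fin n) ℝ}
    (hA : IsMetzler A) {μ₀ : ℂ} {v₀ : Fin n → ℂ} (hv₀ : v₀ ≠ 0)
    (hAv₀ : (A.map (fun x : ℝ => (x : ℂ))).mulVec v₀ = μ₀ • v₀) :
    ∃ ρ : ℝ, (ρ • (1 : Matrix (Fin n) (Fin n) ℝ) - A).det = 0 ∧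
      ∀ (μ : ℂ) (v : Fin n → ℂ), v ≠ 0 →
        (A.map (fun x : ℝ => (x : ℂ))).mulVec v = μ • v → μ.re ≤ ρ := by
  have hne := positivityDomain_nonempty A
  have hbdd : BddBelow (positivityDomain A) :=
    ⟨μ₀.re, fun z hz => (hA.re_lt_of_mem_positivityDomain hv₀ hAv₀ hz).le⟩
  refine ⟨sInf (positivityDomain A), ?_, fun μ v hv h => le_csInf hne fun z hz =>
    (hA.re_lt_of_mem_positivityDomain hv h hz).le⟩
  by_contra hdet
  have hmem : sInf (positivityDomain A) ∈ positivityDomain A := by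
    refine hA.mem_positivityDomain_of_isUnit (fun w hw => ?_) hdet
    obtain ⟨z, hz, hzw⟩ := exists_lt_of_csInf_lt hne hw
    exact positivityDomain_upward hz hzw.le
  obtain ⟨l, hl, hlI⟩ := exists_Ioc_subset_of_mem_nhds
    ((positivityDomain_isOpen A).mem_nhds hmem) ⟨_, sub_one_lt _⟩
  have h1 : (l + sInf (positivityDomain A)) / 2 ∈ positivityDomain A :=
    hlI ⟨by linarith, by linarith⟩
  have h2 := csInf_le hbdd h1
  linarith

/-! ### Cycle expansions and trace inequalities for `4 × 4` Metzler matrices -/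

/-- The determinant of a `4 × 4` matrix with diagonal `w` and nonpositive off-diagonal entries,
expanded in cycle weights: `qᵢⱼ` is the weight of the 2-cycle through `i` and `j`, `cᵢ` the total
weight of the 3-cycles avoiding `i`, and `f` the total weight of the 4-cycles. -/
def cyclePoly (w₀ w₁ w₂ w₃ q₀₁ q₀₂ q₀₃ q₁₂ q₁₃ q₂₃ c₀ c₁ c₂ c₃ f : ℝ) : ℝ :=
  w₀ * w₁ * w₂ * w₃ - q₀₁ * w₂ * w₃ - q₀₂ * w₁ * w₃ - q₀₃ * w₁ * w₂ - q₁₂ * w₀ * w₃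
    - q₁₃ * w₀ * w₂ - q₂₃ * w₀ * w₁ - c₀ * w₀ - c₁ * w₁ - c₂ * w₂ - c₃ * w₃ - f
    + q₀₁ * q₂₃ + q₀₂ * q₁₃ + q₀₃ * q₁₂

theorem det_smul_one_sub_eq_cyclePoly (B : Matrix (Fin 4) (Fin 4) ℝ) (z : ℝ) :
    (z • (1 : Matrix (Fin 4) (Fin 4) ℝ) - B).det =
      cyclePoly (z - B 0 0) (z - B 1 1) (z - B 2 2) (z - B 3 3)
        (B 0 1 * B 1 0) (B 0 2 * B 2 0) (B 0 3 * B 3 0)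
        (B 1 2 * B 2 1) (B 1 3 * B 3 1) (B 2 3 * B 3 2)
        (B 1 2 * B 2 3 * B 3 1 + B 1 3 * B 3 2 * B 2 1)
        (B 0 2 * B 2 3 * B 3 0 + B 0 3 * B 3 2 * B 2 0)
        (B 0 1 * B 1 3 * B 3 0 + B 0 3 * B 3 1 * B 1 0)
        (B 0 1 * B 1 2 * B 2 0 + B 0 2 * B 2 1 * B 1 0)
        (B 0 1 * B 1 2 * B 2 3 * B 3 0 + B 0 1 * B 1 3 * B 3 2 * B 2 0
          + B 0 2 * B 2 1 * B 1 3 * B 3 0 + B 0 2 * B 2 3 * B 3 1 * B 1 0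
          + B 0 3 * B 3 1 * B 1 2 * B 2 0 + B 0 3 * B 3 2 * B 2 1 * B 1 0) := by
  simp [Matrix.det_succ_row_zero, Fin.sum_univ_succ, Fin.succAbove, cyclePoly, Matrix.one_apply]
  ring

theorem trace_pow_two_fin_four (B : Matrix (Fin 4) (Fin 4) ℝ) :
    (B ^ 2).trace = B 0 0 ^ 2 + B 1 1 ^ 2 + B 2 2 ^ 2 + B 3 3 ^ 2
      + 2 * (B 0 1 * B 1 0 + B 0 2 * B 2 0 + B 0 3 * B 3 0
        + B 1 2 * B 2 1 + B 1 3 * B 3 1 + B 2 3 * B 3 2) := by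
  simp [pow_succ, Matrix.trace, Matrix.mul_apply, Fin.sum_univ_succ]
  ring

theorem trace_pow_three_fin_four (B : Matrix (Fin 4) (Fin 4) ℝ) :
    (B ^ 3).trace = B 0 0 ^ 3 + B 1 1 ^ 3 + B 2 2 ^ 3 + B 3 3 ^ 3
      + 3 * (B 0 1 * B 1 0 * (B 0 0 + B 1 1) + B 0 2 * B 2 0 * (B 0 0 + B 2 2)
        + B 0 3 * B 3 0 * (B 0 0 + B 3 3) + B 1 2 * B 2 1 * (B 1 1 + B 2 2)
        + B 1 3 * B 3 1 * (B 1 1 + B 3 3) + B 2 3 * B 3 2 * (B 2 2 + B 3 3))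
      + 3 * ((B 1 2 * B 2 3 * B 3 1 + B 1 3 * B 3 2 * B 2 1)
        + (B 0 2 * B 2 3 * B 3 0 + B 0 3 * B 3 2 * B 2 0)
        + (B 0 1 * B 1 3 * B 3 0 + B 0 3 * B 3 1 * B 1 0)
        + (B 0 1 * B 1 2 * B 2 0 + B 0 2 * B 2 1 * B 1 0)) := by
  simp [pow_succ, Matrix.trace, Matrix.mul_apply, Fin.sum_univ_succ]
  ring

/-- The sign condition survives lowering one diagonal entry: `cyclePoly` is affine in it, and its
value at zero is nonpositive as soon as the 2-cycles among the other indices are dominated. -/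
theorem cyclePoly_nonpos_of_le {w₀ v w₁ w₂ w₃ q₀₁ q₀₂ q₀₃ q₁₂ q₁₃ q₂₃ c₀ c₁ c₂ c₃ f : ℝ}
    (hv : 0 ≤ v) (hvw : v ≤ w₀) (h₁ : 0 ≤ w₁) (h₂ : 0 ≤ w₂) (h₃ : 0 ≤ w₃)
    (h₀₁ : 0 ≤ q₀₁) (h₀₂ : 0 ≤ q₀₂) (h₀₃ : 0 ≤ q₀₃)
    (h₁₂ : q₁₂ ≤ w₁ * w₂) (h₁₃ : q₁₃ ≤ w₁ * w₃) (h₂₃ : q₂₃ ≤ w₂ * w₃)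
    (hc₁ : 0 ≤ c₁) (hc₂ : 0 ≤ c₂) (hc₃ : 0 ≤ c₃) (hf : 0 ≤ f)
    (h : cyclePoly w₀ w₁ w₂ w₃ q₀₁ q₀₂ q₀₃ q₁₂ q₁₃ q₂₃ c₀ c₁ c₂ c₃ f ≤ 0) :
    cyclePoly v w₁ w₂ w₃ q₀₁ q₀₂ q₀₃ q₁₂ q₁₃ q₂₃ c₀ c₁ c₂ c₃ f ≤ 0 := by
  let M := w₁ * w₂ * w₃ - q₁₂ * w₃ - q₁₃ * w₂ - q₂₃ * w₁ - c₀
  let N := q₀₁ * (w₂ * w₃ - q₂₃) + q₀₂ * (w₁ * w₃ - q₁₃) + q₀₃ * (w₁ * w₂ - q₁₂)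
    + c₁ * w₁ + c₂ * w₂ + c₃ * w₃ + f
  have hN : 0 ≤ N := by
    have := sub_nonneg.2 h₁₂
    have := sub_nonneg.2 h₁₃
    have := sub_nonneg.2 h₂₃
    positivity
  have e : ∀ t, cyclePoly t w₁ w₂ w₃ q₀₁ q₀₂ q₀₃ q₁₂ q₁₃ q₂₃ c₀ c₁ c₂ c₃ f = t * M - N := by
    intro t
    simp only [cyclePoly, M, N]
    ring
  rw [e] at h ⊢
  rcases le_total M 0 with hM | hM
  · have := mul_nonpos_of_nonneg_of_nonpos hv hM
    linarith
  · have := mul_le_mul_of_nonneg_right hvw hM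
    linarith

theorem IsMetzler.mul_symm_nonneg {n : ℕ} {B : Matrix (Fin n) (Fin n) ℝ} (hB : IsMetzler B)
    (i j : Fin n) (h : i ≠ j := by decide) : 0 ≤ B i j * B j i :=
  mul_nonneg (hB i j h) (hB j i h.symm)

/-- If the 2-cycles of a Metzler matrix are dominated by its negative diagonal, also after a
downward shift by `η`, then the sign of the characteristic polynomial persists from `0` to `-η`. -/
theorem IsMetzler.det_neg_smul_one_sub_nonpos {B : Matrix (Fin 4) (Fin 4) ℝ} (hB : IsMetzler B)
    {η : ℝ} (hη : 0 ≤ η) (hd : ∀ i, 0 ≤ -η - B i i)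
    (hq : ∀ i j, i ≠ j → B i j * B j i ≤ (-η - B i i) * (-η - B j j))
    (h0 : ((0 : ℝ) • (1 : Matrix (Fin 4) (Fin 4) ℝ) - B).det ≤ 0) :
    ((-η) • (1 : Matrix (Fin 4) (Fin 4) ℝ) - B).det ≤ 0 := by
  rw [det_smul_one_sub_eq_cyclePoly] at h0 ⊢
  have hle : ∀ i, -η - B i i ≤ 0 - B i i := fun i => by linarith
  have hw : ∀ i, 0 ≤ 0 - B i i := fun i => (hd i).trans (hle i)
  have h3 : ∀ i j k : Fin 4, i ≠ j → j ≠ k → k ≠ i → 0 ≤ B i j * B j k * B k i :=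
    fun i j k h1 h2 h3 => mul_nonneg (mul_nonneg (hB _ _ h1) (hB _ _ h2)) (hB _ _ h3)
  have h4 : ∀ i j k l : Fin 4, i ≠ j → j ≠ k → k ≠ l → l ≠ i →
      0 ≤ B i j * B j k * B k l * B l i := fun i j k l h1 h2 h3 h4 =>
    mul_nonneg (mul_nonneg (mul_nonneg (hB _ _ h1) (hB _ _ h2)) (hB _ _ h3))
      (hB _ _ h4)
  set c₀ := B 1 2 * B 2 3 * B 3 1 + B 1 3 * B 3 2 * B 2 1
  set c₁ := B 0 2 * B 2 3 * B 3 0 + B 0 3 * B 3 2 * B 2 0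
  set c₂ := B 0 1 * B 1 3 * B 3 0 + B 0 3 * B 3 1 * B 1 0
  set c₃ := B 0 1 * B 1 2 * B 2 0 + B 0 2 * B 2 1 * B 1 0
  set f := B 0 1 * B 1 2 * B 2 3 * B 3 0 + B 0 1 * B 1 3 * B 3 2 * B 2 0
    + B 0 2 * B 2 1 * B 1 3 * B 3 0 + B 0 2 * B 2 3 * B 3 1 * B 1 0
    + B 0 3 * B 3 1 * B 1 2 * B 2 0 + B 0 3 * B 3 2 * B 2 1 * B 1 0
  have hc₀ : 0 ≤ c₀ := add_nonneg (h3 1 2 3 (by decide) (by decide) (by decide))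
    (h3 1 3 2 (by decide) (by decide) (by decide))
  have hc₁ : 0 ≤ c₁ := add_nonneg (h3 0 2 3 (by decide) (by decide) (by decide))
    (h3 0 3 2 (by decide) (by decide) (by decide))
  have hc₂ : 0 ≤ c₂ := add_nonneg (h3 0 1 3 (by decide) (by decide) (by decide))
    (h3 0 3 1 (by decide) (by decide) (by decide))
  have hc₃ : 0 ≤ c₃ := add_nonneg (h3 0 1 2 (by decide) (by decide) (by decide))
    (h3 0 2 1 (by decide) (by decide) (by decide))
  have hf : 0 ≤ f := by
    refine add_nonneg (add_nonneg (add_nonneg (add_nonneg (add_nonneg ?_ ?_) ?_) ?_) ?_) ?_ <;>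
    exact h4 _ _ _ _ (by decide) (by decide) (by decide) (by decide)
  have hq0 : ∀ i j : Fin 4, i ≠ j → B i j * B j i ≤ (0 - B i i) * (0 - B j j) := fun i j h =>
    (hq i j h).trans (mul_le_mul (hle i) (hle j) (hd j) (hw i))
  have hq1 : ∀ i j : Fin 4, i ≠ j → B i j * B j i ≤ (-η - B i i) * (0 - B j j) := fun i j h =>
    (hq i j h).trans (mul_le_mul_of_nonneg_left (hle j) (hd i))
  have hp : ∀ i j : Fin 4, i ≠ j → 0 ≤ B i j * B j i := fun i j h => hB.mul_symm_nonneg i j h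
  -- The four diagonal entries are lowered in turn; each step brings the relevant index to the front.
  replace h0 := cyclePoly_nonpos_of_le (hd 0) (hle 0) (hw 1) (hw 2) (hw 3)
    (hp 0 1 (by decide)) (hp 0 2 (by decide)) (hp 0 3 (by decide))
    (hq0 1 2 (by decide)) (hq0 1 3 (by decide)) (hq0 2 3 (by decide)) hc₁ hc₂ hc₃ hf h0
  have s1 : ∀ w₀ w₁ w₂ w₃ q₀₁ q₀₂ q₀₃ q₁₂ q₁₃ q₂₃ c₀ c₁ c₂ c₃ f : ℝ,
      cyclePoly w₀ w₁ w₂ w₃ q₀₁ q₀₂ q₀₃ q₁₂ q₁₃ q₂₃ c₀ c₁ c₂ c₃ f =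
      cyclePoly w₁ w₂ w₃ w₀ q₁₂ q₁₃ q₀₁ q₂₃ q₀₂ q₀₃ c₁ c₂ c₃ c₀ f := by
    intros
    simp only [cyclePoly]
    ring
  rw [s1] at h0
  replace h0 := cyclePoly_nonpos_of_le (hd 1) (hle 1) (hw 2) (hw 3) (hd 0)
    (hp 1 2 (by decide)) (hp 1 3 (by decide)) (hp 0 1 (by decide))
    (hq0 2 3 (by decide)) (by rw [mul_comm (0 - B 2 2)]; exact hq1 0 2 (by decide))
    (by rw [mul_comm (0 - B 3 3)]; exact hq1 0 3 (by decide)) hc₂ hc₃ hc₀ hf h0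
  rw [s1] at h0
  replace h0 := cyclePoly_nonpos_of_le (hd 2) (hle 2) (hw 3) (hd 0) (hd 1)
    (hp 2 3 (by decide)) (hp 0 2 (by decide)) (hp 1 2 (by decide))
    (by rw [mul_comm (0 - B 3 3)]; exact hq1 0 3 (by decide))
    (by rw [mul_comm (0 - B 3 3)]; exact hq1 1 3 (by decide))
    (hq 0 1 (by decide)) hc₃ hc₀ hc₁ hf h0
  rw [s1] at h0
  replace h0 := cyclePoly_nonpos_of_le (hd 3) (hle 3) (hd 0) (hd 1) (hd 2)
    (hp 0 3 (by decide)) (hp 1 3 (by decide)) (hp 2 3 (by decide))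
    (hq 0 1 (by decide)) (hq 0 2 (by decide)) (hq 1 2 (by decide)) hc₀ hc₁ hc₂ hf h0
  rwa [s1] at h0

/-- For `p = x * y` the difference of the two sides is
`2 * (x + y - (z + w) / 2) ^ 2 + 3 / 2 * (z - w) ^ 2`. -/
theorem sq_sum_le_of_mul_le {x y z w p : ℝ} (h : x * y ≤ p) :
    (x + y + z + w) ^ 2 ≤ 3 * (x ^ 2 + y ^ 2 + z ^ 2 + w ^ 2 + 2 * p) := by
  nlinarith [sq_nonneg (x + y - (z + w) / 2), sq_nonneg (z - w)]

/-- A matrix-level form of the bound `√3 |ω| ≤ ρ - a` on a conjugate pair `a ± iω`: it holds as soon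
as the second real eigenvalue, here shifted to `0`, is at least the mean of the spectrum. -/
theorem IsMetzler.sq_trace_le_three_mul_trace_sq {B : Matrix (Fin 4) (Fin 4) ℝ} (hB : IsMetzler B)
    (htr : B.trace ≤ 0) (h0 : ((0 : ℝ) • (1 : Matrix (Fin 4) (Fin 4) ℝ) - B).det ≤ 0)
    (hpos : ∀ η : ℝ, 0 < η → 0 < ((-η) • (1 : Matrix (Fin 4) (Fin 4) ℝ) - B).det) :
    B.trace ^ 2 ≤ 3 * (B ^ 2).trace := by
  have ht : B.trace = B 0 0 + B 1 1 + B 2 2 + B 3 3 := by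
    simp [Matrix.trace, Fin.sum_univ_succ]
    ring
  have q01 := hB.mul_symm_nonneg 0 1
  have q02 := hB.mul_symm_nonneg 0 2
  have q03 := hB.mul_symm_nonneg 0 3
  have q12 := hB.mul_symm_nonneg 1 2
  have q13 := hB.mul_symm_nonneg 1 3
  have q23 := hB.mul_symm_nonneg 2 3
  rw [trace_pow_two_fin_four]
  rw [ht] at htr ⊢
  -- A nonnegative diagonal entry may be dropped, and three numbers satisfy Cauchy–Schwarz.
  by_cases hneg : ∀ i, B i i < 0
  swap
  · obtain ⟨i, hi⟩ := not_forall.1 hneg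
    rw [not_lt] at hi
    have h := mul_nonneg_of_nonpos_of_nonpos htr (neg_nonpos.2 hi)
    fin_cases i <;> simp only [Fin.zero_eta, Fin.mk_one, Fin.reduceFinMk] at h <;>
    nlinarith [sq_nonneg (B 0 0), sq_nonneg (B 1 1), sq_nonneg (B 2 2), sq_nonneg (B 3 3),
      sq_nonneg (B 0 0 - B 1 1), sq_nonneg (B 0 0 - B 2 2), sq_nonneg (B 0 0 - B 3 3),
      sq_nonneg (B 1 1 - B 2 2), sq_nonneg (B 1 1 - B 3 3), sq_nonneg (B 2 2 - B 3 3)]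
  by_contra! hlt
  have hsmall : ∀ i j, i ≠ j → B i j * B j i < (0 - B i i) * (0 - B j j) := by
    have n01 : B 0 1 * B 1 0 < B 0 0 * B 1 1 := by
      by_contra! h
      linarith [sq_sum_le_of_mul_le (z := B 2 2) (w := B 3 3) h]
    have n02 : B 0 2 * B 2 0 < B 0 0 * B 2 2 := by
      by_contra! h
      linarith [sq_sum_le_of_mul_le (z := B 1 1) (w := B 3 3) h]
    have n03 : B 0 3 * B 3 0 < B 0 0 * B 3 3 := by
      by_contra! h
      linarith [sq_sum_le_of_mul_le (z := B 1 1) (w := B 2 2) h]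
    have n12 : B 1 2 * B 2 1 < B 1 1 * B 2 2 := by
      by_contra! h
      linarith [sq_sum_le_of_mul_le (z := B 0 0) (w := B 3 3) h]
    have n13 : B 1 3 * B 3 1 < B 1 1 * B 3 3 := by
      by_contra! h
      linarith [sq_sum_le_of_mul_le (z := B 0 0) (w := B 2 2) h]
    have n23 : B 2 3 * B 3 2 < B 2 2 * B 3 3 := by
      by_contra! h
      linarith [sq_sum_le_of_mul_le (z := B 0 0) (w := B 1 1) h]
    intro i j hij
    fin_cases i <;> fin_cases j <;> first
      | exact absurd rfl hij
      | (simp only [Fin.zero_eta, Fin.mk_one, Fin.reduceFinMk, zero_sub, neg_mul_neg]; linarith)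
  have hev1 : ∀ᶠ η in nhds (0 : ℝ), ∀ i, 0 < -η - B i i := by
    refine Filter.eventually_all.2 fun i => ?_
    have hc : Continuous fun η : ℝ => -η - B i i := by fun_prop
    refine hc.continuousAt.eventually_const_lt ?_
    have := hneg i
    linarith
  have hev2 : ∀ᶠ η in nhds (0 : ℝ), ∀ i j, i ≠ j →
      B i j * B j i < (-η - B i i) * (-η - B j j) := by
    refine Filter.eventually_all.2 fun i => Filter.eventually_all.2 fun j => ?_
    by_cases hij : i = j
    · simp [hij]
    have hc : Continuous fun η : ℝ => (-η - B i i) * (-η - B j j) := by fun_prop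
    have h0 : B i j * B j i < (-0 - B i i) * (-0 - B j j) := by
      rw [neg_zero]
      exact hsmall i j hij
    exact (hc.continuousAt.eventually_const_lt h0).mono fun η h _ => h
  obtain ⟨η, ⟨h1, h2⟩, hη⟩ := (((hev1.and hev2).filter_mono
    nhdsWithin_le_nhds).and (self_mem_nhdsWithin (s := Set.Ioi (0 : ℝ)))).exists
  exact absurd (hpos η hη) (not_lt.2 (hB.det_neg_smul_one_sub_nonpos (le_of_lt hη)
    (fun i => (h1 i).le) (fun i j hij => (h2 i j hij).le) h0))

/-- For four reals of mean zero, the third moment is smallest for a multiple of `(1, 1, 1, -3)`. -/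
theorem neg_le_sum_cubes_of_sum_eq_zero {x y z w τ : ℝ} (hτ : 0 ≤ τ) (h1 : x + y + z + w = 0)
    (h2 : x ^ 2 + y ^ 2 + z ^ 2 + w ^ 2 = 12 * τ ^ 2) :
    -24 * τ ^ 3 ≤ x ^ 3 + y ^ 3 + z ^ 3 + w ^ 3 := by
  have key : ∀ x y z w : ℝ, x + y + z + w = 0 → x ^ 2 + y ^ 2 + z ^ 2 + w ^ 2 = 12 * τ ^ 2 →
      0 ≤ (x - τ) ^ 2 * (x + 3 * τ) := by
    intro x y z w h1 h2
    have hx : x = -(y + z + w) := by linarith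
    have : x ^ 2 ≤ (3 * τ) ^ 2 := by
      subst hx
      nlinarith [sq_nonneg (y - z), sq_nonneg (y - w), sq_nonneg (z - w)]
    have := (abs_le_of_sq_le_sq' this (by positivity)).1
    exact mul_nonneg (sq_nonneg _) (by linarith)
  have kx := key x y z w h1 h2
  have ky := key y x z w (by linarith) (by linarith)
  have kz := key z x y w (by linarith) (by linarith)
  have kw := key w x y z (by linarith) (by linarith)
  have e : (x - τ) ^ 2 * (x + 3 * τ) + (y - τ) ^ 2 * (y + 3 * τ) + (z - τ) ^ 2 * (z + 3 * τ)
      + (w - τ) ^ 2 * (w + 3 * τ) = x ^ 3 + y ^ 3 + z ^ 3 + w ^ 3 + 24 * τ ^ 3 := by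
    linear_combination τ * h2 - 5 * τ ^ 2 * h1
  linarith

/-- The case of a single 2-cycle of weight `Q`: such a matrix has the spectrum of a symmetric
matrix, so the bound for real spectra applies. -/
theorem neg_le_sum_cubes_add_two_cycle {x y z w Q τ : ℝ} (hτ : 0 ≤ τ) (hQ : 0 ≤ Q)
    (h1 : x + y + z + w = 0) (h2 : x ^ 2 + y ^ 2 + z ^ 2 + w ^ 2 + 2 * Q = 12 * τ ^ 2) :
    -24 * τ ^ 3 ≤ x ^ 3 + y ^ 3 + z ^ 3 + w ^ 3 + 3 * Q * (x + y) := by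
  have hD : √((x - y) ^ 2 + 4 * Q) ^ 2 = (x - y) ^ 2 + 4 * Q := Real.sq_sqrt (by positivity)
  set D := √((x - y) ^ 2 + 4 * Q)
  have := neg_le_sum_cubes_of_sum_eq_zero (x := (x + y + D) / 2) (y := (x + y - D) / 2)
    (z := z) (w := w) hτ (by linarith) (by linear_combination h2 + hD / 2)
  have e : ((x + y + D) / 2) ^ 3 + ((x + y - D) / 2) ^ 3 = x ^ 3 + y ^ 3 + 3 * Q * (x + y) := by
    linear_combination 3 / 4 * (x + y) * hD
  linarith

/-- The third moment of a trace-zero Metzler matrix obeys the lower bound valid for real spectra: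
3-cycles only help, and the contribution of the 2-cycles is a convex combination of the
contributions of single 2-cycles. -/
theorem IsMetzler.neg_le_trace_pow_three {B : Matrix (Fin 4) (Fin 4) ℝ} (hB : IsMetzler B) {τ : ℝ}
    (hτ : 0 ≤ τ) (h1 : B.trace = 0) (h2 : (B ^ 2).trace = 12 * τ ^ 2) :
    -24 * τ ^ 3 ≤ (B ^ 3).trace := by
  have ht : B.trace = B 0 0 + B 1 1 + B 2 2 + B 3 3 := by
    simp [Matrix.trace, Fin.sum_univ_succ]
    ring
  have q01 := hB.mul_symm_nonneg 0 1
  have q02 := hB.mul_symm_nonneg 0 2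
  have q03 := hB.mul_symm_nonneg 0 3
  have q12 := hB.mul_symm_nonneg 1 2
  have q13 := hB.mul_symm_nonneg 1 3
  have q23 := hB.mul_symm_nonneg 2 3
  have h3 : ∀ i j k : Fin 4, i ≠ j → j ≠ k → k ≠ i → 0 ≤ B i j * B j k * B k i :=
    fun i j k h1 h2 h3 => mul_nonneg (mul_nonneg (hB _ _ h1) (hB _ _ h2)) (hB _ _ h3)
  have c0 := add_nonneg (h3 1 2 3 (by decide) (by decide) (by decide))
    (h3 1 3 2 (by decide) (by decide) (by decide))
  have c1 := add_nonneg (h3 0 2 3 (by decide) (by decide) (by decide))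
    (h3 0 3 2 (by decide) (by decide) (by decide))
  have c2 := add_nonneg (h3 0 1 3 (by decide) (by decide) (by decide))
    (h3 0 3 1 (by decide) (by decide) (by decide))
  have c3 := add_nonneg (h3 0 1 2 (by decide) (by decide) (by decide))
    (h3 0 2 1 (by decide) (by decide) (by decide))
  rw [trace_pow_two_fin_four] at h2
  rw [trace_pow_three_fin_four]
  rw [ht] at h1
  generalize B 0 1 * B 1 0 = p01 at *
  generalize B 0 2 * B 2 0 = p02 at *
  generalize B 0 3 * B 3 0 = p03 at *
  generalize B 1 2 * B 2 1 = p12 at *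
  generalize B 1 3 * B 3 1 = p13 at *
  generalize B 2 3 * B 3 2 = p23 at *
  obtain ⟨Q, hQ⟩ : ∃ Q, Q = p01 + p02 + p03 + p12 + p13 + p23 := ⟨_, rfl⟩
  rw [← hQ] at h2
  have hQ0 : 0 ≤ Q := by rw [hQ]; positivity
  have k01 := neg_le_sum_cubes_add_two_cycle (x := B 0 0) (y := B 1 1) (z := B 2 2) (w := B 3 3)
    hτ hQ0 (by linarith) (by linarith)
  have k02 := neg_le_sum_cubes_add_two_cycle (x := B 0 0) (y := B 2 2) (z := B 1 1) (w := B 3 3)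
    hτ hQ0 (by linarith) (by linarith)
  have k03 := neg_le_sum_cubes_add_two_cycle (x := B 0 0) (y := B 3 3) (z := B 1 1) (w := B 2 2)
    hτ hQ0 (by linarith) (by linarith)
  have k12 := neg_le_sum_cubes_add_two_cycle (x := B 1 1) (y := B 2 2) (z := B 0 0) (w := B 3 3)
    hτ hQ0 (by linarith) (by linarith)
  have k13 := neg_le_sum_cubes_add_two_cycle (x := B 1 1) (y := B 3 3) (z := B 0 0) (w := B 2 2)
    hτ hQ0 (by linarith) (by linarith)
  have k23 := neg_le_sum_cubes_add_two_cycle (x := B 2 2) (y := B 3 3) (z := B 0 0) (w := B 1 1)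
    hτ hQ0 (by linarith) (by linarith)
  rcases hQ0.eq_or_lt with h | h
  · obtain rfl : p01 = 0 := by linarith
    obtain rfl : p02 = 0 := by linarith
    obtain rfl : p03 = 0 := by linarith
    obtain rfl : p12 = 0 := by linarith
    obtain rfl : p13 = 0 := by linarith
    obtain rfl : p23 = 0 := by linarith
    rw [← h] at k01
    linarith
  · refine le_of_mul_le_mul_left ?_ h
    have m01 := mul_le_mul_of_nonneg_left k01 q01
    have m02 := mul_le_mul_of_nonneg_left k02 q02
    have m03 := mul_le_mul_of_nonneg_left k03 q03
    have m12 := mul_le_mul_of_nonneg_left k12 q12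
    have m13 := mul_le_mul_of_nonneg_left k13 q13
    have m23 := mul_le_mul_of_nonneg_left k23 q23
    have hc := mul_nonneg hQ0 (add_nonneg (add_nonneg (add_nonneg c0 c1) c2) c3)
    have hS : Q * (B 0 0 ^ 3 + B 1 1 ^ 3 + B 2 2 ^ 3 + B 3 3 ^ 3 + 24 * τ ^ 3) =
      (p01 + p02 + p03 + p12 + p13 + p23) *
        (B 0 0 ^ 3 + B 1 1 ^ 3 + B 2 2 ^ 3 + B 3 3 ^ 3 + 24 * τ ^ 3) := by rw [hQ]
    linarith

/-! ### Spectra with a conjugate pair -/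

/-- The spectrum of a real Metzler matrix with a conjugate pair `a ± iω`. If `√3 |ω| ≤ ρ - a`, three
eigenvalues are carried by a `3 × 3` block. Otherwise `l` lies below the mean `m` of the spectrum;
in the coordinate `X` centred at `m` the characteristic polynomial is then that of a nonnegative
companion matrix if `a ≤ m`, and it has the form
`(X - τ) ^ 2 * ((X + τ) ^ 2 - 4 τ ^ 2) - C (X - τ) - F` with `12 τ ^ 2 = tr (A - m) ^ 2` and
`C, F ≥ 0` if `a ≥ m`. -/
theorem IsMetzler.isHessenbergRealizable_of_conj {A : Matrix (Fin 4) (Fin 4) ℝ} (hA : IsMetzler A)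
    {d : Fin 4 → ℂ} {ρ l a ω : ℝ} (h0 : d 0 = ρ) (h1 : d 1 = l) (h2 : d 2 = a + ω * Complex.I)
    (h3 : d 3 = a - ω * Complex.I) (hω : ω ≠ 0) (hl : l ≤ ρ) (ha : a ≤ ρ)
    (hdet : ∀ z : ℝ, (z • (1 : Matrix (Fin 4) (Fin 4) ℝ) - A).det =
      (z - ρ) * (z - l) * ((z - a) ^ 2 + ω ^ 2))
    (htr1 : ∀ m : ℝ, (A - m • (1 : Matrix (Fin 4) (Fin 4) ℝ)).trace =
      (ρ - m) + (l - m) + 2 * (a - m))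
    (htr2 : ∀ m : ℝ, ((A - m • (1 : Matrix (Fin 4) (Fin 4) ℝ)) ^ 2).trace =
      (ρ - m) ^ 2 + (l - m) ^ 2 + 2 * (a - m) ^ 2 - 2 * ω ^ 2)
    (htr3 : ∀ m : ℝ, ((A - m • (1 : Matrix (Fin 4) (Fin 4) ℝ)) ^ 3).trace =
      (ρ - m) ^ 3 + (l - m) ^ 3 + 2 * (a - m) ^ 3 - 6 * (a - m) * ω ^ 2) :
    IsHessenbergRealizable d := by
  have hω2 : 0 < ω ^ 2 := by positivity
  have hshift : ∀ m : ℝ, IsMetzler (A - m • (1 : Matrix (Fin 4) (Fin 4) ℝ)) := by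
    intro m i j hij
    simpa [Matrix.one_apply_ne hij] using hA i j hij
  have hpair : ∀ i, i = 2 ∨ i = 3 → (d i - a) ^ 2 + (ω : ℂ) ^ 2 = 0 := by
    rintro i (rfl | rfl)
    · rw [h2]
      linear_combination (ω : ℂ) ^ 2 * Complex.I_sq
    · rw [h3]
      linear_combination (ω : ℂ) ^ 2 * Complex.I_sq
  have hchar : ∀ i, (d i - ρ) * (d i - l) * ((d i - a) ^ 2 + (ω : ℂ) ^ 2) = 0 := by
    intro i
    fin_cases i
    · simp [h0]
    · simp [h1]
    · simp [hpair 2]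
    · simp [hpair 3]
  have hreal : ∀ x : ℝ, (x : ℂ) ≠ d 2 ∧ (x : ℂ) ≠ d 3 := by
    intro x
    constructor <;> intro h <;> apply hω <;> have := congrArg Complex.im h
    · simpa [h2] using this.symm
    · simpa [h3] using this
  have h23 : d 2 ≠ d 3 := by
    intro h
    have := congrArg Complex.im h
    simp only [h2, h3, Complex.add_im, Complex.sub_im, Complex.ofReal_im, Complex.mul_im,
      Complex.ofReal_re, Complex.I_re, Complex.I_im] at this
    exact hω (by linarith)
  have hinj : l ≠ ρ → Function.Injective d := by
    intro hne
    have h01 : d 0 ≠ d 1 := by rw [h0, h1]; exact_mod_cast hne.symm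
    have h02 : d 0 ≠ d 2 := by rw [h0]; exact (hreal ρ).1
    have h03 : d 0 ≠ d 3 := by rw [h0]; exact (hreal ρ).2
    have h12 : d 1 ≠ d 2 := by rw [h1]; exact (hreal l).1
    have h13 : d 1 ≠ d 3 := by rw [h1]; exact (hreal l).2
    intro i j hij
    fin_cases i <;> fin_cases j <;> first
      | rfl
      | (exfalso; simp only [Fin.zero_eta, Fin.mk_one, Fin.reduceFinMk] at hij; simp_all)
  by_cases hcone : 3 * ω ^ 2 ≤ (ρ - a) ^ 2
  · obtain ⟨e, he⟩ : ∃ e, e = (ρ + 2 * a) / 3 := ⟨_, rfl⟩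
    obtain ⟨q, hq⟩ : ∃ q, q = (ρ - a) ^ 2 / 3 - ω ^ 2 := ⟨_, rfl⟩
    obtain ⟨C, hC⟩ : ∃ C, C = 2 * (ρ - a) / 3 * ((ρ - a) ^ 2 / 9 + ω ^ 2) := ⟨_, rfl⟩
    have hq0 : 0 ≤ q := by rw [hq]; linarith
    have hC0 : 0 ≤ C := by
      rw [hC]
      have := sub_nonneg.2 ha
      positivity
    have hcubic : ∀ z : ℂ, (z - e) * (z - e) * (z - e) - (q * (z - e) + C) =
        (z - ρ) * ((z - a) ^ 2 + (ω : ℂ) ^ 2) := by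
      intro z
      rw [he, hq, hC]
      push_cast
      ring
    by_cases hne : l = ρ
    · refine .of_perm (Equiv.swap 1 3) ?_
      have e0 : Equiv.swap (1 : Fin 4) 3 0 = 0 := by decide
      have e2 : Equiv.swap (1 : Fin 4) 3 2 = 2 := by decide
      refine isHessenbergRealizable_of_three ?_ ?_ ?_ e e e ρ hq0 hC0 ?_ fun i => ?_
      · simpa [e0, h0] using (hreal ρ).2
      · simpa [e0, e2, h0] using (hreal ρ).1
      · simpa [e2] using h23.symm
      · simp [h1, hne]
      · refine sub_eq_zero.1 ((hcubic _).trans ?_)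
        simp only [Function.comp_apply]
        generalize Equiv.swap (1 : Fin 4) 3 i = k
        fin_cases k
        · simp [h0]
        · simp [h1, hne]
        · simp [hpair 2]
        · simp [hpair 3]
    · refine isHessenbergRealizable_of_injective (hinj hne) l e e e hq0 hC0 le_rfl fun i => ?_
      push_cast
      linear_combination (d i - l) * hcubic (d i) + hchar i
  rw [not_le] at hcone
  have hlm : 3 * l < ρ + 2 * a := by
    by_contra! hlm
    have := (hshift l).sq_trace_le_three_mul_trace_sq (by rw [htr1]; linarith) ?_ ?_
    · rw [htr1, htr2] at this
      nlinarith
    · have e : (0 : ℝ) • (1 : Matrix (Fin 4) (Fin 4) ℝ) - (A - l • 1) = l • 1 - A := by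
        rw [zero_smul]; abel
      rw [e, hdet]
      simp
    · intro η hη
      have e : (-η) • (1 : Matrix (Fin 4) (Fin 4) ℝ) - (A - l • 1) = (l - η) • 1 - A := by
        rw [sub_smul, neg_smul]; abel
      rw [e, hdet]
      exact mul_pos (mul_pos_of_neg_of_neg (by linarith) (by linarith)) (by positivity)
  have hne : l ≠ ρ := by
    rintro rfl
    linarith
  obtain ⟨m, hm⟩ : ∃ m, m = (ρ + l + 2 * a) / 4 := ⟨_, rfl⟩
  have hs1 : (A - m • (1 : Matrix (Fin 4) (Fin 4) ℝ)).trace = 0 := by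
    rw [htr1, hm]; ring
  have hs2 := htr2 m
  have hs3 := htr3 m
  have hnn : 0 ≤ ((A - m • (1 : Matrix (Fin 4) (Fin 4) ℝ)) ^ 2).trace := by
    have q01 := (hshift m).mul_symm_nonneg 0 1
    have q02 := (hshift m).mul_symm_nonneg 0 2
    have q03 := (hshift m).mul_symm_nonneg 0 3
    have q12 := (hshift m).mul_symm_nonneg 1 2
    have q13 := (hshift m).mul_symm_nonneg 1 3
    have q23 := (hshift m).mul_symm_nonneg 2 3
    rw [trace_pow_two_fin_four]
    positivity
  -- From here on everything is expressed in the coordinate centred at the mean.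
  obtain ⟨R, rfl⟩ : ∃ R, ρ = R + m := ⟨ρ - m, by ring⟩
  obtain ⟨L, rfl⟩ : ∃ L, l = L + m := ⟨l - m, by ring⟩
  obtain ⟨x, rfl⟩ : ∃ x, a = x + m := ⟨a - m, by ring⟩
  obtain rfl : L = -R - 2 * x := by linarith
  simp only [add_sub_cancel_right] at hs2 hs3
  obtain ⟨k₂, hk₂⟩ : ∃ k₂, k₂ = 3 * x ^ 2 + R * (R + 2 * x) - ω ^ 2 := ⟨_, rfl⟩
  obtain ⟨k₃, hk₃⟩ : ∃ k₃, k₃ = -2 * x * ((R + x) ^ 2 + ω ^ 2) := ⟨_, rfl⟩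
  obtain ⟨k₄, hk₄⟩ : ∃ k₄, k₄ = R * (R + 2 * x) * (x ^ 2 + ω ^ 2) := ⟨_, rfl⟩
  have hs2' : ((A - m • (1 : Matrix (Fin 4) (Fin 4) ℝ)) ^ 2).trace = 2 * k₂ := by
    rw [hs2, hk₂]; ring
  have hs3' : ((A - m • (1 : Matrix (Fin 4) (Fin 4) ℝ)) ^ 3).trace = 3 * k₃ := by
    rw [hs3, hk₃]; ring
  have hquartic : ∀ i, (d i - m) ^ 4 = k₂ * (d i - m) ^ 2 + k₃ * (d i - m) + k₄ := by
    intro i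
    have := hchar i
    rw [hk₂, hk₃, hk₄]
    push_cast at this ⊢
    linear_combination this
  have hk₂0 : 0 ≤ k₂ := by linarith
  have hR : 0 ≤ R := by linarith
  have hRx : 0 ≤ R + 2 * x := by linarith
  rcases le_total x 0 with hx | hx
  · have hk₃0 : 0 ≤ k₃ := by
      rw [hk₃]
      have : 0 ≤ -2 * x := by linarith
      positivity
    have hk₄0 : 0 ≤ k₄ := by rw [hk₄]; positivity
    refine isHessenbergRealizable_of_injective (hinj hne) m m m m hk₂0 hk₃0 hk₄0 fun i => ?_
    linear_combination hquartic i
  · obtain ⟨τ, hτ⟩ : ∃ τ, τ = √(k₂ / 6) := ⟨_, rfl⟩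
    have hτ0 : 0 ≤ τ := by rw [hτ]; exact Real.sqrt_nonneg _
    have hτ2 : 6 * τ ^ 2 = k₂ := by
      rw [hτ, Real.sq_sqrt (by positivity)]; ring
    have hC := (hshift m).neg_le_trace_pow_three hτ0 hs1 (by rw [hs2', ← hτ2]; ring)
    rw [hs3'] at hC
    have hτR : τ ≤ R := by
      refine (sq_le_sq₀ hτ0 hR).1 ?_
      nlinarith
    have hF : 0 ≤ (R - τ) * (τ + R + 2 * x) * ((τ - x) ^ 2 + ω ^ 2) := by
      have := sub_nonneg.2 hτR
      positivity
    refine isHessenbergRealizable_of_injective (hinj hne) (m + τ) (m + τ) (m - τ) (m - τ)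
      (q := 4 * τ ^ 2) (C := k₃ + 8 * τ ^ 3)
      (F := (R - τ) * (τ + R + 2 * x) * ((τ - x) ^ 2 + ω ^ 2))
      (by positivity) (by linarith) hF fun i => ?_
    have hF' : (R - τ) * (τ + R + 2 * x) * ((τ - x) ^ 2 + ω ^ 2) =
        -τ ^ 4 + k₂ * τ ^ 2 + k₃ * τ + k₄ := by
      rw [hk₂, hk₃, hk₄]; ring
    have hτ2' : 6 * (τ : ℂ) ^ 2 = k₂ := by exact_mod_cast hτ2
    rw [hF']
    push_cast
    linear_combination hquartic i - ((d i - m) ^ 2 - τ ^ 2) * hτ2'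

/-! ### The controller-Hessenberg form -/

theorem mainTheorem10
    (A : Matrix (Fin 4) (Fin 4) ℝ) (b : Fin 4 → ℝ)
    (hA : IsMetzler A) (hb : ∀ i, 0 ≤ b i)
    (V : Matrix (Fin 4) (Fin 4) ℂ) (d : Fin 4 → ℂ) (hV : IsUnit V)
    (hdiag : V⁻¹ * A.map (fun x : ℝ => (x : ℂ)) * V = Matrix.diagonal d)
    (he : ∀ i, 0 < ‖(V⁻¹.mulVec (Pi.single 0 1)) i‖)
    (hVb : ∀ i, 0 < ‖(V⁻¹.mulVec (fun j => (b j : ℂ))) i‖) :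
    ∃ T : Matrix (Fin 4) (Fin 4) ℝ, IsUnit T ∧
      IsCTPositiveControllerHessenberg (T⁻¹ * A * T) (T⁻¹.mulVec b) := by
  suffices h : IsHessenbergRealizable d from
    h.exists_similarity A b V hV hdiag fun i => norm_pos_iff.1 (hVb i)
  have hVd : IsUnit V.det := (Matrix.isUnit_iff_isUnit_det _).1 hV
  set Ac := A.map (fun x : ℝ => (x : ℂ)) with hAc
  have hAV : Ac * V = V * Matrix.diagonal d := by
    rw [← hdiag, ← Matrix.mul_assoc, ← Matrix.mul_assoc, Matrix.mul_nonsing_inv _ hVd,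
      Matrix.one_mul]
  have hAeq : Ac = V * Matrix.diagonal d * V⁻¹ := by
    rw [← hAV, Matrix.mul_assoc, Matrix.mul_nonsing_inv _ hVd, Matrix.mul_one]
  have hsub : ∀ z : ℂ, Ac - z • (1 : Matrix (Fin 4) (Fin 4) ℂ) =
      V * Matrix.diagonal (fun i => d i - z) * V⁻¹ := by
    intro z
    have : (Matrix.diagonal fun i => d i - z) =
        Matrix.diagonal d - z • (1 : Matrix (Fin 4) (Fin 4) ℂ) := by
      rw [Matrix.smul_one_eq_diagonal, Matrix.diagonal_sub]
    rw [this, Matrix.mul_sub, Matrix.sub_mul, ← hAeq, Matrix.mul_smul, Matrix.mul_one,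
      Matrix.smul_mul, Matrix.mul_nonsing_inv _ hVd]
  have hdetC : ∀ z : ℂ, (z • (1 : Matrix (Fin 4) (Fin 4) ℂ) - Ac).det = ∏ i, (z - d i) := by
    intro z
    rw [← neg_sub, hsub, Matrix.det_neg, Matrix.det_mul, Matrix.det_mul, Matrix.det_diagonal,
      mul_right_comm, ← Matrix.det_mul, Matrix.mul_nonsing_inv _ hVd]
    simp [Fin.prod_univ_succ]
    ring
  have hdetR : ∀ z : ℝ, (((z • (1 : Matrix (Fin 4) (Fin 4) ℝ) - A).det : ℝ) : ℂ) =
      ∏ i, ((z : ℂ) - d i) := by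
    intro z
    rw [← hdetC, ← Complex.ofRealHom_eq_coe, RingHom.map_det]
    congr 1
    ext i j
    simp [hAc, Matrix.one_apply, apply_ite]
  have htrR : ∀ (m : ℝ) (k : ℕ), ((((A - m • (1 : Matrix (Fin 4) (Fin 4) ℝ)) ^ k).trace : ℝ) : ℂ) =
      ∑ i, (d i - m) ^ k := by
    intro m k
    have e1 : (((A - m • (1 : Matrix (Fin 4) (Fin 4) ℝ)) ^ k).trace : ℂ) =
        ((Ac - (m : ℂ) • 1) ^ k).trace := by
      rw [← Complex.ofRealHom_eq_coe, AddMonoidHom.map_trace, ← RingHom.mapMatrix_apply, map_pow]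
      congr 2
      ext i j
      rcases eq_or_ne i j with rfl | h
      · simp [hAc]
      · simp [hAc, Matrix.one_apply_ne h]
    have e2 : ∀ k : ℕ, (Ac - (m : ℂ) • 1) ^ k =
        V * Matrix.diagonal (fun i => (d i - m) ^ k) * V⁻¹ := by
      intro k
      induction k with
      | zero => simp [Matrix.mul_nonsing_inv _ hVd]
      | succ k ih =>
        rw [pow_succ, ih, hsub]
        calc _ = V * Matrix.diagonal (fun i => (d i - m) ^ k) * (V⁻¹ * V) *
              Matrix.diagonal (fun i => d i - m) * V⁻¹ := by simp only [Matrix.mul_assoc]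
          _ = _ := by
            rw [Matrix.nonsing_inv_mul _ hVd, Matrix.mul_one, Matrix.mul_assoc V,
              Matrix.diagonal_mul_diagonal]
            simp only [pow_succ]
    rw [e1, e2, Matrix.trace_mul_cycle, Matrix.nonsing_inv_mul _ hVd, Matrix.one_mul,
      Matrix.trace_diagonal]
  have heig : ∀ j, V.col j ≠ 0 ∧ Ac.mulVec (V.col j) = d j • V.col j := by
    intro j
    constructor
    · intro h
      have := congrFun (congrFun (Matrix.nonsing_inv_mul _ hVd) j) j
      rw [Matrix.mul_apply] at this
      have h' : ∀ i, V i j = 0 := fun i => congrFun h i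
      simp [h'] at this
    · ext i
      have := congrFun (congrFun hAV i) j
      rw [Matrix.mul_diagonal] at this
      simpa [Matrix.mul_apply, Matrix.mulVec, dotProduct, mul_comm] using this
  obtain ⟨ρ, hρdet, hρ⟩ := hA.exists_dominant_eigenvalue (heig 0).1 (heig 0).2
  have hρ' : ∀ j, (d j).re ≤ ρ := fun j => hρ _ _ (heig j).1 (heig j).2
  obtain ⟨i, hi⟩ : ∃ i, d i = ρ := by
    have := hdetR ρ
    rw [hρdet, Complex.ofReal_zero] at this
    obtain ⟨i, -, hi⟩ := Finset.prod_eq_zero_iff.1 this.symm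
    exact ⟨i, (sub_eq_zero.1 hi).symm⟩
  by_cases hre : ∀ j, (d j).im = 0
  · have : d = fun j => (((d j).re : ℝ) : ℂ) := by
      ext j
      exact Complex.ext (by simp) (by simp [hre j])
    rw [this]
    exact isHessenbergRealizable_ofReal _
  obtain ⟨j, hj⟩ := not_forall.1 hre
  -- The characteristic polynomial is real, so the conjugate of an eigenvalue is an eigenvalue.
  obtain ⟨k, hk⟩ : ∃ k, d k = starRingEnd ℂ (d j) := by
    have h1 : (starRingEnd ℂ (d j) • (1 : Matrix (Fin 4) (Fin 4) ℂ) - Ac).det = 0 := by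
      have h2 : (d j • (1 : Matrix (Fin 4) (Fin 4) ℂ) - Ac).det = 0 := by
        rw [hdetC]
        exact Finset.prod_eq_zero (Finset.mem_univ j) (sub_self _)
      have h3 := congrArg (starRingEnd ℂ) h2
      rw [RingHom.map_det, map_zero] at h3
      rw [← h3]
      congr 1
      ext s t
      simp [hAc, Matrix.one_apply, apply_ite]
    rw [hdetC] at h1
    obtain ⟨k, -, hk⟩ := Finset.prod_eq_zero_iff.1 h1
    exact ⟨k, (sub_eq_zero.1 hk).symm⟩
  have hij : i ≠ j := by
    rintro rfl
    simp [hi] at hj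
  have hik : i ≠ k := by
    rintro rfl
    rw [hi] at hk
    have := congrArg Complex.im hk
    simp at this
    exact hj this
  have hjk : j ≠ k := by
    rintro rfl
    have := congrArg Complex.im hk
    rw [Complex.conj_im] at this
    exact hj (by linarith)
  obtain ⟨σ, hσ0, hσ2, hσ3⟩ : ∃ σ : Equiv.Perm (Fin 4), σ 0 = i ∧ σ 2 = j ∧ σ 3 = k := by
    clear hi hj hk
    revert i j k
    decide
  have hd0 : d (σ 0) = ρ := by rw [hσ0, hi]
  have hd2 : d (σ 2) = (d j).re + (d j).im * Complex.I := by rw [hσ2, Complex.re_add_im]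
  have hd3 : d (σ 3) = (d j).re - (d j).im * Complex.I := by
    rw [hσ3, hk]
    exact Complex.ext (by simp) (by simp)
  -- The trace is real, so the remaining eigenvalue is real as well.
  have hd1 : d (σ 1) = ((d (σ 1)).re : ℝ) := by
    have h1 := congrArg Complex.im (htrR 0 1)
    rw [← Equiv.sum_comp σ] at h1
    simp only [Fin.sum_univ_four, hd0, hd2, hd3] at h1
    simp at h1
    exact Complex.ext (by simp) (by simp [h1])
  refine .of_perm σ (hA.isHessenbergRealizable_of_conj (d := d ∘ σ) (ρ := ρ) (l := (d (σ 1)).re)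
    (a := (d j).re) (ω := (d j).im) hd0 hd1 hd2 hd3 hj (hρ' _) (hρ' _) ?_ ?_ ?_ ?_)
  · intro z
    have h1 := hdetR z
    rw [← Equiv.prod_comp σ, Fin.prod_univ_four, hd0, hd1, hd2, hd3] at h1
    apply Complex.ofReal_injective
    rw [h1]
    push_cast
    linear_combination -(z - ρ) * (z - ((d (σ 1)).re : ℂ)) * (d j).im ^ 2 * Complex.I_sq
  · intro m
    have h1 := htrR m 1
    rw [← Equiv.sum_comp σ, Fin.sum_univ_four, hd0, hd1, hd2, hd3, pow_one] at h1
    apply Complex.ofReal_injective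
    rw [h1]
    push_cast
    ring
  · intro m
    have h1 := htrR m 2
    rw [← Equiv.sum_comp σ, Fin.sum_univ_four, hd0, hd1, hd2, hd3] at h1
    apply Complex.ofReal_injective
    rw [h1]
    push_cast
    linear_combination 2 * (d j).im ^ 2 * Complex.I_sq
  · intro m
    have h1 := htrR m 3
    rw [← Equiv.sum_comp σ, Fin.sum_univ_four, hd0, hd1, hd2, hd3] at h1
    apply Complex.ofReal_injective
    rw [h1]
    push_cast
    linear_combination 6 * (((d j).re : ℂ) - m) * (d j).im ^ 2 * Complex.I_sq
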